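/- Let $n\ge 1$ be an integer, $0<\alpha<2$ with $\alpha<n$ (automatic if $n\ge 2$), and $1<p<\frac{n+\alpha}{n-\alpha}$. Let $A_{n,\alpha}=\frac{\Gamma((n-\alpha)/2)}{2^{\alpha}\pi^{n/2}\Gamma(\alpha/2)}$, so that $G_\infty(x,y)=A_{n,\alpha}|x-y|^{\alpha-n}$ is the Green's function of $(-\Delta)^{\alpha/2}$ in $\mathbb{R}^n$. Let $u:\mathbb{R}^n\to\mathbb{R}$ be measurable with $\int_{\mathbb{R}^n}\frac{|u(x)|}{1+|x|^{n+\alpha}}\,dx<\infty$ (that is, $u\in\mathcal{L}_{\alpha/2}$) and $u\in L^\infty_{loc}(\mathbb{R}^n)$. If $u\ge 0$ almost everywhere and $$u(x)=\int_{\mathbb{R}^n}\frac{A_{n,\alpha}}{|x-y|^{n-\alpha}}\,y_n^2\,u^p(y)\,dy$$ for almost every $x\in\mathbb{R}^n$ (the integral being finite), then $u=0$ almost everywhere. If moreover the equation holds at every $x\in\mathbb{R}^n$, then $u(x)=0$ for every $x\in\mathbb{R}^n$. -/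

import Mathlib

open MeasureTheory Filter

noncomputable section

namespace FracLiouville

/-- The last coordinate `x_n` of a point `x = (x_1, …, x_n)` of `ℝⁿ`, for `n ≥ 1`. -/
def lastCoord {n : ℕ} (hn : 1 ≤ n) (x : EuclideanSpace ℝ (Fin n)) : ℝ :=
  x ⟨n - 1, Nat.sub_lt hn Nat.one_pos⟩

/-- The space `L_{α/2}` of measurable functions `u` on `ℝⁿ` with
`∫ |u(x)| / (1 + |x|^{n+α}) dx < ∞`. -/
def MemLHalf {n : ℕ} (α : ℝ) (u : EuclideanSpace ℝ (Fin n) → ℝ) : Prop :=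
  AEStronglyMeasurable u volume ∧
    Integrable (fun x => |u x| / (1 + ‖x‖ ^ ((n : ℝ) + α))) volume

/-- The space `L^∞_loc(ℝⁿ)`: essentially bounded on every compact set. -/
def MemLinftyLoc {n : ℕ} (u : EuclideanSpace ℝ (Fin n) → ℝ) : Prop :=
  ∀ K : Set (EuclideanSpace ℝ (Fin n)), IsCompact K → MemLp u ⊤ (volume.restrict K)

/-- The constant `A_{n,α}` of the fundamental solution of `(-Δ)^{α/2}` on `ℝⁿ`
(for `0 < α < n`, the operator having Fourier symbol `|ξ|^α`). -/
def greenConst (n : ℕ) (α : ℝ) : ℝ :=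
  Real.Gamma (((n : ℝ) - α) / 2) /
    (2 ^ α * Real.pi ^ ((n : ℝ) / 2) * Real.Gamma (α / 2))

/-- The Green's function `G_∞(x, y) = A_{n,α} / |x - y|^{n-α}` of `(-Δ)^{α/2}` on `ℝⁿ`. -/
def greenFun {n : ℕ} (α : ℝ) (x y : EuclideanSpace ℝ (Fin n)) : ℝ :=
  greenConst n α / ‖x - y‖ ^ ((n : ℝ) - α)

/-- The integral equation `u(x) = ∫ G_∞(x, y) y_n² u(y)^p dy` at the point `x`; the integral
is required to converge. -/
def SolvesAt {n : ℕ} (hn : 1 ≤ n) (α p : ℝ) (u : EuclideanSpace ℝ (Fin n) → ℝ)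
    (x : EuclideanSpace ℝ (Fin n)) : Prop :=
  Integrable (fun y => greenFun α x y * lastCoord hn y ^ 2 * u y ^ p) volume ∧
    u x = ∫ y, greenFun α x y * lastCoord hn y ^ 2 * u y ^ p

end FracLiouville

end

namespace FracLiouville

/-! Let F(R) be the integral of y_n² u^p over the ball B_R. Two points of B_R lie within 2R, so the
equation gives u ≥ A (2R)^{α-n} F(R) a.e. on B_R (`SolvesAt.le_apply`). Raising this to the power p
and integrating against y_n² bounds F(R) below by a multiple of R^{n+2-p(n-α)} F(R)^p. The exponent
of R is positive, p > 1 and F is nondecreasing, so F(R) > 0 for some R is impossible as R → ∞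
(`nonpos_of_rpow_growth`). Hence the source vanishes a.e., and u = 0 wherever the equation holds. -/

lemma continuous_lastCoord {n : ℕ} (hn : 1 ≤ n) :
    Continuous (lastCoord hn : EuclideanSpace ℝ (Fin n) → ℝ) := by
  unfold lastCoord
  fun_prop

lemma greenConst_pos {n : ℕ} {α : ℝ} (hα0 : 0 < α) (hαn : α < n) : 0 < greenConst n α := by
  unfold greenConst
  have h1 : 0 < Real.Gamma (((n : ℝ) - α) / 2) := Real.Gamma_pos_of_pos (by linarith)
  have h2 : 0 < Real.Gamma (α / 2) := Real.Gamma_pos_of_pos (by linarith)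
  have := Real.pi_pos
  positivity

lemma greenFun_nonneg {n : ℕ} {α : ℝ} (hα0 : 0 < α) (hαn : α < n)
    (x y : EuclideanSpace ℝ (Fin n)) : 0 ≤ greenFun α x y :=
  div_nonneg (greenConst_pos hα0 hαn).le (Real.rpow_nonneg (norm_nonneg _) _)

/-- The diagonal is excluded because division by zero makes `greenFun α x x` equal to 0. -/
lemma le_greenFun {n : ℕ} {α r : ℝ} (hα0 : 0 < α) (hαn : α < n)
    {x y : EuclideanSpace ℝ (Fin n)} (hxy : x ≠ y) (h : ‖x - y‖ ≤ r) :
    greenConst n α / r ^ ((n : ℝ) - α) ≤ greenFun α x y := by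
  have h0 : 0 < ‖x - y‖ := norm_pos_iff.2 (sub_ne_zero.2 hxy)
  exact div_le_div_of_nonneg_left (greenConst_pos hα0 hαn).le (Real.rpow_pos_of_pos h0 _)
    (Real.rpow_le_rpow h0.le h (by linarith))

lemma integrableOn_lastCoord_sq {n : ℕ} (hn : 1 ≤ n) (R : ℝ) :
    IntegrableOn (fun y : EuclideanSpace ℝ (Fin n) => lastCoord hn y ^ 2)
      (Metric.ball 0 R) volume :=
  (((continuous_lastCoord hn).pow 2).continuousOn.integrableOn_compact
    (isCompact_closedBall 0 R)).mono_set Metric.ball_subset_closedBall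

lemma setIntegral_lastCoord_sq_pos {n : ℕ} (hn : 1 ≤ n) :
    0 < ∫ y in Metric.ball (0 : EuclideanSpace ℝ (Fin n)) 1, lastCoord hn y ^ 2 := by
  rw [setIntegral_pos_iff_support_of_nonneg_ae (ae_of_all _ fun y => sq_nonneg _)
    (integrableOn_lastCoord_sq hn 1)]
  refine IsOpen.measure_pos _ ?_ ?_
  · exact (((continuous_lastCoord hn).pow 2).isOpen_support).inter Metric.isOpen_ball
  · refine ⟨EuclideanSpace.single ⟨n - 1, Nat.sub_lt hn Nat.one_pos⟩ (1 / 2 : ℝ), ?_, ?_⟩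
    · simp [lastCoord]
    · simp only [Metric.mem_ball, dist_zero_right, PiLp.norm_single]
      norm_num

/-- Dilation by R: the Jacobian gives R^n and the weight, homogeneous of degree 2, gives R². -/
lemma setIntegral_lastCoord_sq {n : ℕ} (hn : 1 ≤ n) {R : ℝ} (hR : 0 < R) :
    ∫ y in Metric.ball (0 : EuclideanSpace ℝ (Fin n)) R, lastCoord hn y ^ 2 =
      R ^ (n + 2) * ∫ y in Metric.ball (0 : EuclideanSpace ℝ (Fin n)) 1, lastCoord hn y ^ 2 := by
  have h := Measure.setIntegral_comp_smul_of_pos (volume : Measure (EuclideanSpace ℝ (Fin n)))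
    (fun y => lastCoord hn y ^ 2) (Metric.ball 0 1) hR
  have hs (y : EuclideanSpace ℝ (Fin n)) : lastCoord hn (R • y) ^ 2 = R ^ 2 * lastCoord hn y ^ 2 := by
    simp [lastCoord, mul_pow]
  simp only [hs, integral_const_mul, smul_unitBall_of_pos hR, finrank_euclideanSpace,
    Fintype.card_fin, smul_eq_mul] at h
  rw [eq_inv_mul_iff_mul_eq₀ (by positivity)] at h
  rw [← h]
  ring

section

variable {n : ℕ} {hn : 1 ≤ n} {α p : ℝ} {u : EuclideanSpace ℝ (Fin n) → ℝ}
  {x : EuclideanSpace ℝ (Fin n)}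

/-- The source term of the equation is integrable on balls as soon as the integral converges
at one point. -/
lemma SolvesAt.integrableOn_ball (hα0 : 0 < α) (hαn : α < n)
    (hum : AEStronglyMeasurable u volume) (hu0 : ∀ᵐ y, 0 ≤ u y)
    (hx : SolvesAt hn α p u x) (R : ℝ) :
    IntegrableOn (fun y => lastCoord hn y ^ 2 * u y ^ p) (Metric.ball 0 R) volume := by
  have : Nonempty (Fin n) := ⟨⟨0, hn⟩⟩
  rcases le_or_gt R 0 with hR | hR
  · simp [Metric.ball_eq_empty.2 hR]
  have hr : 0 < ‖x‖ + R := by positivity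
  -- A positive lower bound for the kernel on the ball, since |x - y| ≤ |x| + R there; k⁻¹ times the
  -- integrand at x then dominates the source.
  set k := greenConst n α / (‖x‖ + R) ^ ((n : ℝ) - α) with hk
  have hkpos : 0 < k := div_pos (greenConst_pos hα0 hαn) (Real.rpow_pos_of_pos hr _)
  have hm : AEStronglyMeasurable (fun y => lastCoord hn y ^ 2 * u y ^ p) volume :=
    ((continuous_lastCoord hn).pow 2).aestronglyMeasurable.mul
      (hum.aemeasurable.pow_const p).aestronglyMeasurable
  refine Integrable.mono' (hx.1.const_mul k⁻¹).integrableOn hm.restrict ?_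
  filter_upwards [ae_restrict_mem Metric.isOpen_ball.measurableSet, ae_restrict_of_ae hu0,
    ae_restrict_of_ae (Measure.ae_ne volume x)] with y hy hu hyx
  have hw : 0 ≤ lastCoord hn y ^ 2 * u y ^ p := mul_nonneg (sq_nonneg _) (Real.rpow_nonneg hu _)
  rw [Real.norm_of_nonneg hw, le_inv_mul_iff₀ hkpos, mul_assoc]
  refine mul_le_mul_of_nonneg_right (le_greenFun hα0 hαn hyx.symm ?_) hw
  exact (norm_sub_le _ _).trans (by simpa using (mem_ball_zero_iff.1 hy).le)

lemma SolvesAt.le_apply (hα0 : 0 < α) (hαn : α < n)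
    (hum : AEStronglyMeasurable u volume) (hu0 : ∀ᵐ y, 0 ≤ u y)
    (hx : SolvesAt hn α p u x) {R : ℝ} (hxR : x ∈ Metric.ball 0 R) :
    greenConst n α / (2 * R) ^ ((n : ℝ) - α) *
      ∫ y in Metric.ball (0 : EuclideanSpace ℝ (Fin n)) R, lastCoord hn y ^ 2 * u y ^ p ≤ u x := by
  have : Nonempty (Fin n) := ⟨⟨0, hn⟩⟩
  have hnn : ∀ᵐ y, 0 ≤ greenFun α x y * lastCoord hn y ^ 2 * u y ^ p := by
    filter_upwards [hu0] with y hu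
    exact mul_nonneg (mul_nonneg (greenFun_nonneg hα0 hαn x y) (sq_nonneg _))
      (Real.rpow_nonneg hu _)
  rw [hx.2, ← integral_const_mul]
  refine le_trans (integral_mono_ae ((hx.integrableOn_ball hα0 hαn hum hu0 R).const_mul _)
    hx.1.integrableOn ?_) (setIntegral_le_integral hx.1 hnn)
  filter_upwards [ae_restrict_mem Metric.isOpen_ball.measurableSet, ae_restrict_of_ae hu0,
    ae_restrict_of_ae (Measure.ae_ne volume x)] with y hy hu hyx
  rw [mul_assoc (greenFun α x y)]
  refine mul_le_mul_of_nonneg_right (le_greenFun hα0 hαn hyx.symm ?_)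
    (mul_nonneg (sq_nonneg _) (Real.rpow_nonneg hu _))
  have := norm_sub_le x y
  rw [mem_ball_zero_iff] at hy hxR
  linarith

/-- The growth estimate `F(R) ≥ M (A (2R)^{α-n} F(R))^p R^{n+2}` for
`F(R) = ∫_{|y| < R} y_n² u(y)^p dy`. -/
lemma rpow_mul_le_setIntegral (hα0 : 0 < α) (hαn : α < n) (hp : 0 < p)
    (hum : AEStronglyMeasurable u volume) (hu0 : ∀ᵐ y, 0 ≤ u y)
    (hu : ∀ᵐ x, SolvesAt hn α p u x) {R : ℝ} (hR : 0 < R) :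
    (greenConst n α / (2 * R) ^ ((n : ℝ) - α) *
      ∫ y in Metric.ball (0 : EuclideanSpace ℝ (Fin n)) R, lastCoord hn y ^ 2 * u y ^ p) ^ p *
      (R ^ (n + 2) * ∫ y in Metric.ball (0 : EuclideanSpace ℝ (Fin n)) 1, lastCoord hn y ^ 2) ≤
    ∫ y in Metric.ball (0 : EuclideanSpace ℝ (Fin n)) R, lastCoord hn y ^ 2 * u y ^ p := by
  obtain ⟨x, hx⟩ := hu.exists
  have hF : 0 ≤ ∫ y in Metric.ball (0 : EuclideanSpace ℝ (Fin n)) R,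
      lastCoord hn y ^ 2 * u y ^ p := by
    refine integral_nonneg_of_ae ?_
    filter_upwards [ae_restrict_of_ae hu0] with y hy
    exact mul_nonneg (sq_nonneg _) (Real.rpow_nonneg hy _)
  have hA := greenConst_pos hα0 hαn
  rw [← setIntegral_lastCoord_sq hn hR, ← integral_const_mul]
  refine integral_mono_ae ((integrableOn_lastCoord_sq hn R).const_mul _)
    (hx.integrableOn_ball hα0 hαn hum hu0 R) ?_
  filter_upwards [ae_restrict_mem Metric.isOpen_ball.measurableSet, ae_restrict_of_ae hu]
    with y hy hyu
  rw [mul_comm]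
  exact mul_le_mul_of_nonneg_left (Real.rpow_le_rpow (by positivity)
    (hyu.le_apply hα0 hαn hum hu0 hy) hp.le) (sq_nonneg _)

end

/-- If `F` is monotone and `F(R) ≥ M (A (2R)^{-s} F(R))^p R^m` for all `R > 0`, with `1 < p` and
`p s < m`, then `F ≤ 0` on `(0, ∞)`. -/
lemma nonpos_of_rpow_growth {F : ℝ → ℝ} (hF : Monotone F) {A M p s : ℝ} {m : ℕ}
    (hA : 0 < A) (hM : 0 < M) (hp : 1 < p) (hs : p * s < m)
    (h : ∀ R, 0 < R → (A / (2 * R) ^ s * F R) ^ p * (R ^ m * M) ≤ F R) {R : ℝ} (hR : 0 < R) :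
    F R ≤ 0 := by
  by_contra! hFR
  -- Monotonicity of F lets F(R) replace F(r) for r ≥ R, so c does not depend on r.
  set c : ℝ := (A / 2 ^ s) ^ p * F R ^ (p - 1) * M with hc
  have hcpos : 0 < c := by positivity
  have hlim : Tendsto (fun r : ℝ => c * r ^ ((m : ℝ) - p * s)) atTop atTop :=
    (tendsto_rpow_atTop (by linarith)).const_mul_atTop hcpos
  obtain ⟨r, hr1, hrR⟩ := ((hlim.eventually_gt_atTop 1).and (eventually_ge_atTop R)).exists
  have hr : 0 < r := hR.trans_le hrR
  have hFr : 0 < F r := hFR.trans_le (hF hrR)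
  have key : (A / (2 * r) ^ s * F r) ^ p * (r ^ m * M) =
      ((A / 2 ^ s) ^ p * F r ^ (p - 1) * M * r ^ ((m : ℝ) - p * s)) * F r := by
    have e1 : F r ^ p = F r ^ (p - 1) * F r := by
      rw [← Real.rpow_add_one hFr.ne', sub_add_cancel]
    have e2 : r ^ ((m : ℝ) - p * s) = r ^ m / (r ^ s) ^ p := by
      rw [Real.rpow_sub hr, Real.rpow_natCast, ← Real.rpow_mul hr.le, mul_comm s p]
    rw [Real.mul_rpow (by positivity) hFr.le, Real.mul_rpow (by norm_num) hr.le, ← div_div,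
      Real.div_rpow (by positivity) (by positivity), e1, e2]
    ring
  have hle := h r hr
  rw [key] at hle
  have h1 : (A / 2 ^ s) ^ p * F r ^ (p - 1) * M * r ^ ((m : ℝ) - p * s) ≤ 1 :=
    le_of_mul_le_mul_right (by simpa using hle) hFr
  have h2 : F R ^ (p - 1) ≤ F r ^ (p - 1) :=
    Real.rpow_le_rpow hFR.le (hF hrR) (by linarith)
  have h3 : c * r ^ ((m : ℝ) - p * s) ≤
      (A / 2 ^ s) ^ p * F r ^ (p - 1) * M * r ^ ((m : ℝ) - p * s) := by
    rw [hc]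
    gcongr
  linarith

/-- The source term `y_n² u^p` of a solution vanishes almost everywhere when
`1 < p` and `p (n - α) < n + 2`. -/
lemma ae_source_eq_zero {n : ℕ} {hn : 1 ≤ n} {α p : ℝ} {u : EuclideanSpace ℝ (Fin n) → ℝ}
    (hα0 : 0 < α) (hαn : α < n) (hp1 : 1 < p) (hp2 : p * ((n : ℝ) - α) < n + 2)
    (hum : AEStronglyMeasurable u volume) (hu0 : ∀ᵐ y, 0 ≤ u y)
    (hu : ∀ᵐ x, SolvesAt hn α p u x) :
    ∀ᵐ y, lastCoord hn y ^ 2 * u y ^ p = 0 := by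
  obtain ⟨x, hx⟩ := hu.exists
  have hint := hx.integrableOn_ball hα0 hαn hum hu0
  have hw : ∀ᵐ y, 0 ≤ lastCoord hn y ^ 2 * u y ^ p := by
    filter_upwards [hu0] with y hy
    exact mul_nonneg (sq_nonneg _) (Real.rpow_nonneg hy _)
  have hmono : Monotone fun R : ℝ =>
      ∫ y in Metric.ball (0 : EuclideanSpace ℝ (Fin n)) R, lastCoord hn y ^ 2 * u y ^ p :=
    fun R S hRS => setIntegral_mono_set (hint S) (ae_restrict_of_ae hw)
      (Metric.ball_subset_ball hRS).eventuallyLE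
  -- Countably many balls exhaust the space; k + 1 keeps every radius positive.
  have hball (k : ℕ) : ∀ᵐ y, y ∈ Metric.ball (0 : EuclideanSpace ℝ (Fin n)) (k + 1) →
      lastCoord hn y ^ 2 * u y ^ p = 0 := by
    have h0 := nonpos_of_rpow_growth hmono (m := n + 2) (greenConst_pos hα0 hαn)
      (setIntegral_lastCoord_sq_pos hn) hp1 (by push_cast; exact hp2)
      (fun R hR => rpow_mul_le_setIntegral hα0 hαn (by linarith) hum hu0 hu hR)
      (R := (k : ℝ) + 1) (by positivity)
    have h1 := (setIntegral_eq_zero_iff_of_nonneg_ae (ae_restrict_of_ae hw) (hint (k + 1))).1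
      (le_antisymm h0 (integral_nonneg_of_ae (ae_restrict_of_ae hw)))
    exact (ae_restrict_iff' Metric.isOpen_ball.measurableSet).1 h1
  filter_upwards [ae_all_iff.2 hball] with y hy
  obtain ⟨k, hk⟩ := exists_nat_gt ‖y‖
  exact hy k (by rw [mem_ball_zero_iff]; linarith)

lemma SolvesAt.eq_zero {n : ℕ} {hn : 1 ≤ n} {α p : ℝ} {u : EuclideanSpace ℝ (Fin n) → ℝ}
    {x : EuclideanSpace ℝ (Fin n)} (hx : SolvesAt hn α p u x)
    (h : ∀ᵐ y, lastCoord hn y ^ 2 * u y ^ p = 0) : u x = 0 := by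
  rw [hx.2]
  refine integral_eq_zero_of_ae ?_
  filter_upwards [h] with y hy
  simp [mul_assoc, hy]

end FracLiouville

theorem theorem2 (n : ℕ) (hn : 1 ≤ n) (α p : ℝ) (hα0 : 0 < α) (hα2 : α < 2) (hαn : α < n)
    (hp1 : 1 < p) (hp2 : p < ((n : ℝ) + α) / ((n : ℝ) - α))
    (u : EuclideanSpace ℝ (Fin n) → ℝ)
    (huL : FracLiouville.MemLHalf α u) (huloc : FracLiouville.MemLinftyLoc u)
    (hu0 : ∀ᵐ x ∂(volume : Measure (EuclideanSpace ℝ (Fin n))), 0 ≤ u x)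
    (hu : ∀ᵐ x ∂(volume : Measure (EuclideanSpace ℝ (Fin n))),
      FracLiouville.SolvesAt hn α p u x) :
    (∀ᵐ x ∂(volume : Measure (EuclideanSpace ℝ (Fin n))), u x = 0) ∧
      ((∀ x, FracLiouville.SolvesAt hn α p u x) → ∀ x, u x = 0) := by
  -- Subcriticality gives p(n-α) < n + α, and α < 2.
  have hpn : p * ((n : ℝ) - α) < n + 2 := by
    have := (lt_div_iff₀ (by linarith)).1 hp2
    linarith
  have h := FracLiouville.ae_source_eq_zero hα0 hαn hp1 hpn huL.1 hu0 hu
  exact ⟨hu.mono fun x hx => hx.eq_zero h, fun hall x => (hall x).eq_zero h⟩
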